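/- Let $F$ be a field of arbitrary characteristic, let $V$ be a non-zero finite-dimensional vector space over $F$, and let $f:V\times V\to F$ be an arbitrary bilinear form. Let $$L(f)=\{x\in\mathfrak{gl}(V)\;:\; f(xv,w)=-f(v,xw)\text{ for all }v,w\in V\}$$ be the Lie algebra of all endomorphisms of $V$ that are skew-adjoint with respect to $f$. Call a Lie algebra semisimple if its only solvable ideal is $0$ (so the zero Lie algebra is semisimple). Then $L(f)$ is semisimple if and only if $\mathrm{char}(F)\neq 2$, $f$ is non-degenerate, and there are subspaces $V_1,V_{-1}$ of $V$ (possibly zero) with $V=V_1\oplus V_{-1}$ and $f(V_1,V_{-1})=0=f(V_{-1},V_1)$ such that the restriction $f_1$ of $f$ to $V_1$ is symmetric, $\dim V_1\neq 2$, and the restriction $f_{-1}$ of $f$ to $V_{-1}$ is skew-symmetric, i.e. $f(v,w)=-f(w,v)$ for all $v,w\in V_{-1}$. -/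

import Mathlib

/-- A bilinear form `g` is skew-symmetric if `g v w = -g w v` for all `v`, `w`. -/
def IsSkewSymmForm {F W : Type*} [Field F] [AddCommGroup W] [Module F W]
    (g : LinearMap.BilinForm F W) : Prop :=
  ∀ v w : W, g v w = -g w v

/-- `V = U ⊥ W`: the space `V` is the direct sum of `U` and `W`, and
`f(U, W) = 0 = f(W, U)` (the form `f` is not assumed to be symmetric). -/
structure IsPerpDecomp {F V : Type*} [Field F] [AddCommGroup V] [Module F V]
    (f : LinearMap.BilinForm F V) (U W : Submodule F V) : Prop where
  isCompl : IsCompl U W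
  left_perp : ∀ u ∈ U, ∀ w ∈ W, f u w = 0
  right_perp : ∀ u ∈ U, ∀ w ∈ W, f w u = 0

/-! ### Abelian ideals, invariance of the radicals, central elements -/

section SkewAdjoint

attribute [local instance 100] LieRing.ofAssociativeRing

variable {F V : Type*} [Field F] [AddCommGroup V] [Module F V] {f : LinearMap.BilinForm F V}

/-! Semisimplicity means having no nonzero abelian ideal.

If it holds, commuting families spanning an ideal vanish (`eq_zero_of_lie_mem_span`), as do central
elements. The identity is central when `2 = 0`; a degenerate form yields abelian ideals or a central
element built from its left and right radicals. If `f` is nondegenerate, its asymmetry `σ` makes `σ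
- σ⁻¹` central and skew-adjoint, so `σ² = 1` and its `±1`-eigenspaces are the symmetric and skew
parts; a symmetric plane would give a one-dimensional ideal.

Conversely, any `t` in an abelian ideal satisfies `[t, [t, x]] = 0` for all `x`. Testing this on the
operators `f(c, ·)b - f(·, b)c` kills `t` on the skew part, and on the symmetric part when its
dimension is not 2. -/

theorem mem_skewAdjointLieSubalgebra_iff {x : Module.End F V} :
    x ∈ skewAdjointLieSubalgebra f ↔ ∀ v w, f (x v) w = -f v (x w) := by
  change x ∈ f.skewAdjointSubmodule ↔ _
  rw [LinearMap.mem_skewAdjointSubmodule]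
  simp [LinearMap.IsSkewAdjoint, LinearMap.IsAdjointPair]

theorem skewAdjointLieSubalgebra_flip :
    skewAdjointLieSubalgebra f.flip = skewAdjointLieSubalgebra f := by
  refine SetLike.ext fun x => ?_
  simp only [mem_skewAdjointLieSubalgebra_iff, LinearMap.BilinForm.flip_apply]
  exact ⟨fun h v w => by rw [h w v, neg_neg], fun h v w => by rw [h w v, neg_neg]⟩

theorem apply_map_eq_zero {y : Module.End F V} (hy : y ∈ skewAdjointLieSubalgebra f) {b : V}
    (hb : f b = 0) : f (y b) = 0 := by
  ext w
  rw [mem_skewAdjointLieSubalgebra_iff.1 hy, hb]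
  simp

theorem flip_apply_map_eq_zero {y : Module.End F V} (hy : y ∈ skewAdjointLieSubalgebra f) {c : V}
    (hc : f.flip c = 0) : f.flip (y c) = 0 :=
  apply_map_eq_zero (skewAdjointLieSubalgebra_flip (f := f) ▸ hy) hc

/-- If the skew-adjoint endomorphisms have trivial radical, then a set of commuting skew-adjoint
endomorphisms whose span is an ideal contains at most the zero endomorphism. -/
theorem eq_zero_of_lie_mem_span [FiniteDimensional F V]
    (h : LieAlgebra.HasTrivialRadical F (skewAdjointLieSubalgebra f)) {S : Set (Module.End F V)}
    (hS : ∀ s ∈ S, s ∈ skewAdjointLieSubalgebra f)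
    (hlie : ∀ y ∈ skewAdjointLieSubalgebra f, ∀ s ∈ S, ⁅y, s⁆ ∈ Submodule.span F S)
    (hcomm : ∀ s ∈ S, ∀ t ∈ S, ⁅s, t⁆ = 0) {s : Module.End F V} (hs : s ∈ S) : s = 0 := by
  rw [LieAlgebra.hasTrivialRadical_iff_no_abelian_ideals] at h
  let I : LieIdeal F ↥(skewAdjointLieSubalgebra f) :=
    { (Submodule.span F S).comap (skewAdjointLieSubalgebra f).toSubmodule.subtype with
      lie_mem := by
        rintro ⟨y, hy⟩ ⟨m, hm⟩ hmem
        change m ∈ Submodule.span F S at hmem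
        change ⁅y, m⁆ ∈ Submodule.span F S
        clear hm
        induction hmem using Submodule.span_induction with
        | mem x hx => exact hlie y hy x hx
        | zero => simp
        | add a b _ _ ha hb => rw [lie_add]; exact add_mem ha hb
        | smul c a _ ha => rw [lie_smul]; exact Submodule.smul_mem _ _ ha }
  have hspan : ∀ a ∈ Submodule.span F S, ∀ b ∈ Submodule.span F S, ⁅a, b⁆ = 0 := by
    intro a ha b hb
    induction ha, hb using Submodule.span_induction₂ with
    | mem_mem x y hx hy => exact hcomm x hx y hy
    | zero_left => simp
    | zero_right => simp
    | add_left x y z _ _ _ h1 h2 => rw [add_lie, h1, h2, add_zero]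
    | add_right x y z _ _ _ h1 h2 => rw [lie_add, h1, h2, add_zero]
    | smul_left r x y _ _ h1 => rw [smul_lie, h1, smul_zero]
    | smul_right r x y _ _ h1 => rw [lie_smul, h1, smul_zero]
  have hI : IsLieAbelian I := by
    refine ⟨fun a b => Subtype.ext (Subtype.ext ?_)⟩
    exact hspan _ a.2 _ b.2
  have hmem : (⟨s, hS s hs⟩ : skewAdjointLieSubalgebra f) ∈ I := Submodule.subset_span hs
  rw [h I hI, LieSubmodule.mem_bot] at hmem
  exact congrArg Subtype.val hmem

theorem eq_zero_of_central [FiniteDimensional F V]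
    (h : LieAlgebra.HasTrivialRadical F (skewAdjointLieSubalgebra f)) {z : Module.End F V}
    (hz : z ∈ skewAdjointLieSubalgebra f)
    (hcomm : ∀ y ∈ skewAdjointLieSubalgebra f, ∀ v, y (z v) = z (y v)) : z = 0 := by
  have hlie : ∀ y ∈ skewAdjointLieSubalgebra f, ⁅y, z⁆ = 0 := fun y hy => by
    ext v
    simp [Ring.lie_def, hcomm y hy v]
  refine eq_zero_of_lie_mem_span h (S := {z}) ?_ ?_ ?_ rfl
  · rintro s rfl; exact hz
  · rintro y hy s rfl; rw [hlie y hy]; exact zero_mem _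
  · rintro s rfl t rfl; exact hlie _ hz

theorem two_ne_zero_of_hasTrivialRadical [FiniteDimensional F V] [Nontrivial V]
    (h : LieAlgebra.HasTrivialRadical F (skewAdjointLieSubalgebra f)) : (2 : F) ≠ 0 := by
  intro h2
  have hneg : ∀ a : F, a = -a := fun a => by
    rw [eq_neg_iff_add_eq_zero, ← two_mul, h2, zero_mul]
  refine one_ne_zero (α := Module.End F V) (eq_zero_of_central h ?_ fun _ _ _ => rfl)
  exact mem_skewAdjointLieSubalgebra_iff.2 fun v w => hneg _

/-! ### Degenerate forms -/

theorem ne_zero_of_hasTrivialRadical [FiniteDimensional F V] [Nontrivial V]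
    (h : LieAlgebra.HasTrivialRadical F (skewAdjointLieSubalgebra f)) : f ≠ 0 := by
  rintro rfl
  refine one_ne_zero (α := Module.End F V) (eq_zero_of_central h ?_ fun _ _ _ => rfl)
  exact mem_skewAdjointLieSubalgebra_iff.2 fun v w => by simp

/-- With `R` the intersection of both radicals, the maps `V → R` killing `R` form an abelian ideal.
As `R ≠ V`, it contains some `φ(·)b ≠ 0`. -/
theorem disjoint_radicals_of_hasTrivialRadical [FiniteDimensional F V] [Nontrivial V]
    (h : LieAlgebra.HasTrivialRadical F (skewAdjointLieSubalgebra f)) {b : V}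
    (hl : f b = 0) (hr : f.flip b = 0) : b = 0 := by
  by_contra hb
  have hR : ∀ y ∈ skewAdjointLieSubalgebra f, ∀ v,
      v ∈ LinearMap.ker f ⊓ LinearMap.ker f.flip → y v ∈ LinearMap.ker f ⊓ LinearMap.ker f.flip := by
    exact fun y hy v hv => ⟨apply_map_eq_zero hy hv.1, flip_apply_map_eq_zero hy hv.2⟩
  set R := LinearMap.ker f ⊓ LinearMap.ker f.flip with hRdef
  have hRtop : R < ⊤ := by
    refine lt_top_iff_ne_top.2 fun htop => ne_zero_of_hasTrivialRadical h ?_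
    ext v w
    have : v ∈ R := htop ▸ Submodule.mem_top
    have : f v = 0 := this.1
    simp [this]
  obtain ⟨φ, hφ, hφR⟩ := Submodule.exists_le_ker_of_lt_top R hRtop
  have hbR : b ∈ R := ⟨hl, hr⟩
  have hzero : φ.smulRight b = 0 := by
    refine eq_zero_of_lie_mem_span h
      (S := {x | (∀ v, x v ∈ R) ∧ ∀ v ∈ R, x v = 0}) ?_ ?_ ?_ ⟨fun v => ?_, fun v hv => ?_⟩
    · rintro x ⟨hx, -⟩
      refine mem_skewAdjointLieSubalgebra_iff.2 fun v w => ?_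
      have h1 : f (x v) = 0 := (hx v).1
      have h2 : f.flip (x w) = 0 := (hx w).2
      have h3 : f v (x w) = 0 := LinearMap.congr_fun h2 v
      rw [h1, h3]; simp
    · rintro y hy x ⟨hx, hx'⟩
      refine Submodule.subset_span ⟨fun v => ?_, fun v hv => ?_⟩
      · exact R.sub_mem (hR y hy _ (hx v)) (hx _)
      · change y (x v) - x (y v) = 0
        rw [hx' v hv, hx' _ (hR y hy v hv)]; simp
    · rintro x ⟨hx, hx'⟩ y ⟨hy, hy'⟩
      ext v
      change x (y v) - y (x v) = 0
      rw [hx' _ (hy v), hy' _ (hx v), sub_zero]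
    · exact R.smul_mem _ hbR
    · have : φ v = 0 := hφR hv
      simp [this]
  apply hφ
  ext v
  have := LinearMap.congr_fun hzero v
  simpa [hb] using this

/-- Leibniz rule: `(b, c) ↦ f(c, ·)b - f(·, b)c` is equivariant under skew-adjoint `y`. -/
theorem lie_sub_smulRight {y : Module.End F V} (hy : y ∈ skewAdjointLieSubalgebra f) (b c : V) :
    ⁅y, (f c).smulRight b - (f.flip b).smulRight c⁆ =
      ((f c).smulRight (y b) - (f.flip (y b)).smulRight c) +
        ((f (y c)).smulRight b - (f.flip b).smulRight (y c)) := by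
  rw [mem_skewAdjointLieSubalgebra_iff] at hy
  ext v
  simp [Ring.lie_def, hy]
  abel

/-- The operators with `b` left radical and orthogonal to the right radical, `c` right radical, span
an abelian ideal. Their vanishing with `c ≠ 0` puts `b` in both radicals. -/
theorem flip_apply_eq_zero_of_left_radical [FiniteDimensional F V] [Nontrivial V]
    (h : LieAlgebra.HasTrivialRadical F (skewAdjointLieSubalgebra f)) {b c : V}
    (hb : f b = 0) (hc : f.flip c = 0) (hc0 : c ≠ 0)
    (hbR : ∀ c, f.flip c = 0 → f c b = 0) : b = 0 := by
  by_contra hb0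
  have hx : (f c).smulRight b - (f.flip b).smulRight c = 0 := by
    refine eq_zero_of_lie_mem_span h (S := {x | ∃ b c, f b = 0 ∧ f.flip c = 0 ∧
      (∀ c, f.flip c = 0 → f c b = 0) ∧ x = (f c).smulRight b - (f.flip b).smulRight c})
      ?_ ?_ ?_ ⟨b, c, hb, hc, hbR, rfl⟩
    · rintro x ⟨b, c, hb, hc, -, rfl⟩
      refine mem_skewAdjointLieSubalgebra_iff.2 fun v w => ?_
      have hc' : f v c = 0 := LinearMap.congr_fun hc v
      simp [hb, hc']
      ring
    · rintro y hy x ⟨b, c, hb, hc, hbc, rfl⟩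
      rw [lie_sub_smulRight hy]
      refine add_mem (Submodule.subset_span ⟨y b, c, apply_map_eq_zero hy hb, hc, fun c hc => ?_, rfl⟩)
        (Submodule.subset_span ⟨b, y c, hb, flip_apply_map_eq_zero hy hc, hbc, rfl⟩)
      have h3 := hbc (y c) (flip_apply_map_eq_zero hy hc)
      rw [mem_skewAdjointLieSubalgebra_iff.1 hy] at h3
      simpa using h3
    · rintro x ⟨b, c, hb, hc, hbc, rfl⟩ y ⟨b', c', hb', hc', hbc', rfl⟩
      ext v
      have e1 : f c c' = 0 := LinearMap.congr_fun hc' c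
      have e2 : f c' c = 0 := LinearMap.congr_fun hc c'
      simp [Ring.lie_def, hb, hb', e1, e2, hbc c' hc', hbc' c hc]
  have hind : f.flip b ≠ 0 := fun h0 => hb0 (disjoint_radicals_of_hasTrivialRadical h hb h0)
  apply hind
  ext v
  have h1 := LinearMap.congr_fun hx v
  have h2 := congrArg f h1
  simp [hb] at h2
  have hfc : f c ≠ 0 := fun h0 => hc0 (disjoint_radicals_of_hasTrivialRadical h h0 hc)
  rcases h2 with h2 | h2
  · simpa using h2
  · exact absurd h2 hfc

/-- If both radicals were nonzero, `f` would pair them perfectly, giving projections `p`, `q` of `V`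
onto them whose difference is central and skew-adjoint. But `p - q` fixes `b₀`. -/
theorem separatingLeft_of_hasTrivialRadical [FiniteDimensional F V] [Nontrivial V]
    (h : LieAlgebra.HasTrivialRadical F (skewAdjointLieSubalgebra f)) {c₀ : V}
    (hc₀ : f.flip c₀ = 0) (hc0 : c₀ ≠ 0) : f.SeparatingLeft := by
  rw [LinearMap.separatingLeft_iff_ker_eq_bot, LinearMap.ker_eq_bot']
  intro b₀ hb₀
  by_contra hb0
  let g : LinearMap.ker f →ₗ[F] Module.Dual F (LinearMap.ker f.flip) :=
    (f.flip.domRestrict₁₂ (LinearMap.ker f) (LinearMap.ker f.flip))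
  have hg : Function.Injective g := by
    rw [← LinearMap.ker_eq_bot, LinearMap.ker_eq_bot']
    rintro ⟨b, hb⟩ hgb
    have : b = 0 := flip_apply_eq_zero_of_left_radical h hb hc₀ hc0 fun c hc =>
      LinearMap.congr_fun hgb ⟨c, hc⟩
    exact Subtype.ext this
  let g' : LinearMap.ker f.flip →ₗ[F] Module.Dual F (LinearMap.ker f) :=
    (f.domRestrict₁₂ (LinearMap.ker f.flip) (LinearMap.ker f))
  have hg' : Function.Injective g' := by
    rw [← LinearMap.ker_eq_bot, LinearMap.ker_eq_bot']
    rintro ⟨c, hc⟩ hgc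
    rw [← skewAdjointLieSubalgebra_flip] at h
    have : c = 0 := flip_apply_eq_zero_of_left_radical h hc (c := b₀) hb₀ hb0 fun b hb =>
      LinearMap.congr_fun hgc ⟨b, hb⟩
    exact Subtype.ext this
  have h1 := LinearMap.finrank_le_finrank_of_injective hg
  have h2 := LinearMap.finrank_le_finrank_of_injective hg'
  rw [Subspace.dual_finrank_eq] at h1 h2
  let e := LinearEquiv.ofInjectiveOfFinrankEq g hg
    (by rw [Subspace.dual_finrank_eq]; exact le_antisymm h1 h2)
  let e' := LinearEquiv.ofInjectiveOfFinrankEq g' hg'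
    (by rw [Subspace.dual_finrank_eq]; exact le_antisymm h2 h1)
  let p : V →ₗ[F] V := (LinearMap.ker f).subtype ∘ₗ e.symm.toLinearMap ∘ₗ
    (LinearMap.ker f.flip).subtype.dualMap ∘ₗ f.flip
  let q : V →ₗ[F] V := (LinearMap.ker f.flip).subtype ∘ₗ e'.symm.toLinearMap ∘ₗ
    (LinearMap.ker f).subtype.dualMap ∘ₗ f
  have hpl : ∀ v, f (p v) = 0 := fun v => (e.symm _).2
  have hqr : ∀ v, f.flip (q v) = 0 := fun v => (e'.symm _).2
  have hp : ∀ v c, f.flip c = 0 → f c (p v) = f c v := fun v c hc =>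
    LinearMap.congr_fun (e.apply_symm_apply ((LinearMap.ker f.flip).subtype.dualMap (f.flip v)))
      ⟨c, hc⟩
  have hq : ∀ v b, f b = 0 → f (q v) b = f v b := fun v b hb =>
    LinearMap.congr_fun (e'.apply_symm_apply ((LinearMap.ker f).subtype.dualMap (f v))) ⟨b, hb⟩
  have hpu : ∀ b, f b = 0 → (∀ c, f.flip c = 0 → f c b = 0) → b = 0 := fun b hb hbc =>
    flip_apply_eq_zero_of_left_radical h hb hc₀ hc0 hbc
  have hqu : ∀ c, f.flip c = 0 → (∀ b, f b = 0 → f c b = 0) → c = 0 := fun c hc hbc =>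
    flip_apply_eq_zero_of_left_radical (f := f.flip) (by rwa [skewAdjointLieSubalgebra_flip])
      hc (c := b₀) hb₀ hb0 hbc
  have hz : p - q = 0 := by
    refine eq_zero_of_central h (mem_skewAdjointLieSubalgebra_iff.2 fun v w => ?_) fun y hy v => ?_
    · have h1 : f v (q w) = 0 := LinearMap.congr_fun (hqr w) v
      have h2 := hp w (q v) (hqr v)
      have h3 := hq v (p w) (hpl w)
      simp [hpl, h1, ← h2, ← h3]
    · have hy' := mem_skewAdjointLieSubalgebra_iff.1 hy
      have h1 : y (p v) = p (y v) := by
        refine sub_eq_zero.1 (hpu _ ?_ fun c hc => ?_)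
        · rw [map_sub, apply_map_eq_zero hy (hpl v), hpl, sub_zero]
        · have := hy' c (p v)
          have h3 := hy' c v
          rw [map_sub, hp _ _ hc, ← neg_eq_iff_eq_neg.2 this, ← neg_eq_iff_eq_neg.2 h3,
            hp _ _ (flip_apply_map_eq_zero hy hc), sub_self]
      have h2 : y (q v) = q (y v) := by
        refine sub_eq_zero.1 (hqu _ ?_ fun b hb => ?_)
        · rw [map_sub, flip_apply_map_eq_zero hy (hqr v), hqr, sub_zero]
        · rw [map_sub, LinearMap.sub_apply, hy', hq _ _ hb, hy', hq _ _ (apply_map_eq_zero hy hb),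
            sub_self]
      simp [h1, h2]
  refine hb0 ?_
  have h1 : p b₀ = b₀ := by
    refine sub_eq_zero.1 (hpu _ ?_ fun c hc => ?_)
    · rw [map_sub, hpl, hb₀, sub_zero]
    · rw [map_sub, hp _ _ hc, sub_self]
  have h2 : q b₀ = 0 := hqu _ (hqr _) fun b hb => by rw [hq _ _ hb, hb₀]; rfl
  have h3 := LinearMap.congr_fun hz b₀
  simpa [h1, h2] using h3

theorem nondegenerate_of_hasTrivialRadical [FiniteDimensional F V] [Nontrivial V]
    (h : LieAlgebra.HasTrivialRadical F (skewAdjointLieSubalgebra f)) : f.Nondegenerate := by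
  have key : ∀ g : LinearMap.BilinForm F V, g.SeparatingLeft → g.SeparatingRight := by
    intro g hg
    rw [LinearMap.separatingLeft_iff_ker_eq_bot] at hg
    intro y hy
    have hsurj : Function.Surjective g :=
      (LinearMap.injective_iff_surjective_of_finrank_eq_finrank
        (Subspace.dual_finrank_eq (K := F) (V := V)).symm).1 (LinearMap.ker_eq_bot.1 hg)
    refine (Module.forall_dual_apply_eq_zero_iff F y).1 fun φ => ?_
    obtain ⟨x, rfl⟩ := hsurj φ
    exact hy x
  by_cases hR : f.SeparatingRight
  · exact ⟨LinearMap.flip_separatingRight.1 (key _ (LinearMap.flip_separatingLeft.2 hR)), hR⟩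
  · exfalso
    have hR' := hR
    rw [LinearMap.SeparatingRight] at hR'
    push Not at hR'
    obtain ⟨c, hc, hc0⟩ := hR'
    exact hR (key f (separatingLeft_of_hasTrivialRadical h (LinearMap.ext hc) hc0))

/-! ### Decomposition of nondegenerate forms -/

theorem isCompl_ker_of_hasTrivialRadical [FiniteDimensional F V] [Nontrivial V]
    (h : LieAlgebra.HasTrivialRadical F (skewAdjointLieSubalgebra f)) (hf : f.Nondegenerate) :
    IsCompl (LinearMap.ker (f - f.flip)) (LinearMap.ker (f + f.flip)) := by
  have h2 := two_ne_zero_of_hasTrivialRadical h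
  -- `σ` is the asymmetry of `f` and `τ` its inverse.
  let σ : Module.End F V := (f.toDual hf).symm.toLinearMap ∘ₗ f.flip
  let τ : Module.End F V := (f.flip.toDual hf.flip).symm.toLinearMap ∘ₗ f
  have hσ : ∀ v w, f (σ w) v = f v w := fun v w =>
    LinearMap.BilinForm.apply_toDual_symm_apply (hB := hf) (f.flip w) v
  have hτ : ∀ v w, f v (τ w) = f w v := fun v w =>
    LinearMap.BilinForm.apply_toDual_symm_apply (hB := hf.flip) (f w) v
  have hστ : σ - τ = 0 := by
    refine eq_zero_of_central h (mem_skewAdjointLieSubalgebra_iff.2 fun v w => ?_) fun y hy v => ?_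
    · have : f (τ v) w = f v (σ w) := by rw [← hσ, hτ]
      simp [hσ, hτ, this]
    · rw [mem_skewAdjointLieSubalgebra_iff] at hy
      have h1 : y (σ v) = σ (y v) := by
        refine LinearMap.ker_eq_bot.1 hf.ker_eq_bot (LinearMap.ext fun w => ?_)
        rw [hy, hσ, hσ, hy, neg_neg]
      have h3 : y (τ v) = τ (y v) := by
        refine LinearMap.ker_eq_bot.1 hf.flip.ker_eq_bot (LinearMap.ext fun w => ?_)
        rw [LinearMap.BilinForm.flip_apply, LinearMap.BilinForm.flip_apply,
          ← neg_eq_iff_eq_neg.2 (hy w (τ v)), hτ, hτ, hy]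
      simp [h1, h3]
  have hσ' : ∀ v w, f v (σ w) = f w v := fun v w => by rw [sub_eq_zero.1 hστ, hτ]
  constructor
  · rw [Submodule.disjoint_def]
    intro v h3 h4
    refine hf.1 v fun w => ?_
    have h3 := LinearMap.congr_fun (LinearMap.mem_ker.1 h3) w
    have h4 := LinearMap.congr_fun (LinearMap.mem_ker.1 h4) w
    simp only [LinearMap.sub_apply, LinearMap.add_apply, LinearMap.zero_apply] at h3 h4
    refine (mul_eq_zero.1 (?_ : 2 * f v w = 0)).resolve_left h2
    linear_combination h3 + h4
  · rw [codisjoint_iff, eq_top_iff]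
    intro v _
    rw [Submodule.mem_sup]
    refine ⟨(2⁻¹ : F) • (v + σ v), ?_, (2⁻¹ : F) • (v - σ v), ?_, ?_⟩
    · refine Submodule.smul_mem _ _ (LinearMap.mem_ker.2 (LinearMap.ext fun w => ?_))
      simp [hσ, hσ']
      ring
    · refine Submodule.smul_mem _ _ (LinearMap.mem_ker.2 (LinearMap.ext fun w => ?_))
      simp [hσ, hσ']
    · rw [← smul_add, add_add_sub_cancel, ← two_smul F v, smul_smul, inv_mul_cancel₀ h2, one_smul]

theorem smulRight_mem_of_flip_eq {ε : F} (hε : ε * ε = 1) {b c : V} (hb : f.flip b = ε • f b)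
    (hc : f.flip c = ε • f c) :
    (f c).smulRight b - (f.flip b).smulRight c ∈ skewAdjointLieSubalgebra f := by
  refine mem_skewAdjointLieSubalgebra_iff.2 fun v w => ?_
  have hb' : ∀ v, f v b = ε * f b v := fun v => LinearMap.congr_fun hb v
  have hc' : ∀ v, f v c = ε * f c v := fun v => LinearMap.congr_fun hc v
  simp [hb', hc']
  linear_combination -(f c v * f b w) * hε

theorem flip_apply_map_eq_smul {ε : F} {y : Module.End F V} (hy : y ∈ skewAdjointLieSubalgebra f)
    {a : V} (ha : f.flip a = ε • f a) : f.flip (y a) = ε • f (y a) := by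
  rw [mem_skewAdjointLieSubalgebra_iff] at hy
  ext v
  have h1 : f (y v) a = ε * f a (y v) := LinearMap.congr_fun ha (y v)
  have h2 := hy v a
  have h3 := hy a v
  simp only [LinearMap.BilinForm.flip_apply, LinearMap.smul_apply, smul_eq_mul]
  linear_combination h2 - h1 - ε * h3

theorem finrank_ker_ne_two [FiniteDimensional F V]
    (h : LieAlgebra.HasTrivialRadical F (skewAdjointLieSubalgebra f)) (hf : f.Nondegenerate) :
    Module.finrank F (LinearMap.ker (f - f.flip)) ≠ 2 := by
  intro hdim
  let e := Module.finBasisOfFinrankEq F _ hdim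
  have he : ∀ i, f.flip (e i) = (1 : F) • f (e i) := fun i => by
    rw [one_smul]
    exact (sub_eq_zero.1 (LinearMap.mem_ker.1 (e i).2)).symm
  have hspan : ∀ y ∈ skewAdjointLieSubalgebra f, ∀ i, ∃ α β : F,
      y (e i) = α • (e 0 : V) + β • (e 1 : V) := by
    intro y hy i
    have hmem : y (e i) ∈ LinearMap.ker (f - f.flip) := by
      have := flip_apply_map_eq_smul hy (he i)
      rw [one_smul] at this
      rw [LinearMap.mem_ker, LinearMap.sub_apply, this, sub_self]
    refine ⟨e.repr ⟨_, hmem⟩ 0, e.repr ⟨_, hmem⟩ 1, ?_⟩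
    have := congrArg (LinearMap.ker (f - f.flip)).subtype (e.sum_repr ⟨_, hmem⟩)
    rw [Fin.sum_univ_two, map_add, map_smul, map_smul] at this
    exact this.symm
  have hX : (f (e 1)).smulRight (e 0 : V) - (f.flip (e 0)).smulRight (e 1 : V) = 0 := by
    refine eq_zero_of_lie_mem_span h
      (S := {(f (e 1)).smulRight (e 0 : V) - (f.flip (e 0)).smulRight (e 1 : V)}) ?_ ?_ ?_ rfl
    · rintro _ rfl
      exact smulRight_mem_of_flip_eq (one_mul 1) (he 0) (he 1)
    · rintro y hy _ rfl
      obtain ⟨α, β, h0⟩ := hspan y hy 0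
      obtain ⟨γ, δ, h1⟩ := hspan y hy 1
      -- The operator is alternating in `(e 0, e 1)`, so `y` scales it by its trace on the plane.
      refine Submodule.mem_span_singleton.2 ⟨α + δ, ?_⟩
      rw [lie_sub_smulRight hy, h0, h1]
      have e0 : ∀ v, f v (e 0) = f (e 0) v := fun v => by simpa using LinearMap.congr_fun (he 0) v
      have e1 : ∀ v, f v (e 1) = f (e 1) v := fun v => by simpa using LinearMap.congr_fun (he 1) v
      ext v
      simp [e0, e1]
      module
    · rintro _ rfl _ rfl
      exact lie_self _
  have hind := e.linearIndependent.map' (LinearMap.ker (f - f.flip)).subtype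
    (Submodule.ker_subtype _)
  have h1 : f (e 1) = 0 := by
    ext v
    have := LinearMap.congr_fun hX v
    simp only [LinearMap.sub_apply, LinearMap.smulRight_apply, LinearMap.zero_apply] at this
    have h3 := Fintype.linearIndependent_iff.1 hind ![f (e 1) v, -f.flip (e 0) v]
      (by simpa [Fin.sum_univ_two, sub_eq_add_neg] using this) 0
    simpa using h3
  exact hind.ne_zero 1 (LinearMap.ker_eq_bot'.1 hf.ker_eq_bot _ h1)

/-! ### Abelian ideals -/

theorem lie_lie_smulRight_apply {t : Module.End F V} (ht : t ∈ skewAdjointLieSubalgebra f)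
    (b c v : V) :
    ⁅t, ⁅t, (f c).smulRight b - (f.flip b).smulRight c⁆⁆ v =
      f c v • t (t b) - f v (t (t b)) • c + (2 : F) • (f (t c) v • t b - f v (t b) • t c) +
        (f (t (t c)) v • b - f v b • t (t c)) := by
  rw [lie_sub_smulRight ht, lie_add, lie_sub_smulRight ht, lie_sub_smulRight ht]
  simp
  module

theorem apply_eq_zero_of_skew_of_sandwich [FiniteDimensional F V] (h2 : (2 : F) ≠ 0)
    (hf : f.Nondegenerate) {t : Module.End F V} (ht : t ∈ skewAdjointLieSubalgebra f) {a : V}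
    (ha : f.flip a = (-1 : F) • f a)
    (hta : ⁅t, ⁅t, (f a).smulRight a - (f.flip a).smulRight a⁆⁆ = 0) : t a = 0 := by
  have ha1 := flip_apply_map_eq_smul ht ha
  have ha2 := flip_apply_map_eq_smul ht ha1
  have key : ∀ v, f a v • t (t a) + (2 : F) • (f (t a) v • t a) + f (t (t a)) v • a = 0 := by
    intro v
    have h := lie_lie_smulRight_apply ht a a v
    have e0 : f v a = -f a v := by simpa using LinearMap.congr_fun ha v
    have e1 : f v (t a) = -f (t a) v := by simpa using LinearMap.congr_fun ha1 v
    have e2 : f v (t (t a)) = -f (t (t a)) v := by simpa using LinearMap.congr_fun ha2 v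
    rw [hta, e0, e1, e2, LinearMap.zero_apply] at h
    refine (smul_right_injective V h2) ?_
    simp only [smul_zero]
    rw [h]
    module
  have hspan : t a ∈ Submodule.span F {a} := by
    by_contra hn
    obtain ⟨φ, hφ, hφa⟩ := Submodule.exists_le_ker_of_notMem hn
    have hφa' : φ a = 0 := hφa (Submodule.mem_span_singleton_self a)
    -- This `v` kills the `t (t a)` term of `key`, leaving `t a` a multiple of `a`.
    let v := (f.flip.toDual hf.flip).symm φ
    have hv : ∀ u, f u v = φ u := fun u =>
      LinearMap.BilinForm.apply_toDual_symm_apply (hB := hf.flip) φ u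
    have h := key v
    rw [hv, hv, hφa', zero_smul, zero_add, smul_smul] at h
    refine hn (Submodule.mem_span_singleton.2 ⟨-((2 * φ (t a))⁻¹ * f (t (t a)) v), ?_⟩)
    rw [neg_smul, mul_smul, eq_neg_of_add_eq_zero_right h, smul_neg, neg_neg, smul_smul,
      inv_mul_cancel₀ (mul_ne_zero h2 hφ), one_smul]
  obtain ⟨r, hr⟩ := Submodule.mem_span_singleton.1 hspan
  by_cases ha0 : a = 0
  · rw [ha0, map_zero]
  have hfa : f a ≠ 0 := fun h0 => ha0 (LinearMap.ker_eq_bot'.1 hf.ker_eq_bot _ h0)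
  obtain ⟨v, hv⟩ := DFunLike.ne_iff.1 hfa
  have h := key v
  simp only [← hr, map_smul, LinearMap.smul_apply, smul_eq_mul] at h
  have h3 : (2 * 2 * (r * r) * f a v) • a = 0 := by
    rw [← h]
    module
  have h4 : r = 0 := by
    simpa [ha0, h2, show f a v ≠ 0 from hv] using h3
  rw [← hr, h4, zero_smul]

/-- In an orthogonal basis, `S` and `T` are the Gram matrices of `t` and `t²`, with `S`
antisymmetric; evaluating `hE` on basis vectors gives quadratic relations forcing `S = 0`. -/
theorem eq_zero_of_symm_of_sandwich {W : Type*} [AddCommGroup W] [Module F W]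
    [FiniteDimensional F W] (h2 : (2 : F) ≠ 0) {B : LinearMap.BilinForm F W} (hB : B.IsSymm)
    (hnd : B.SeparatingLeft) (hdim : Module.finrank F W ≠ 2) {t : Module.End F W}
    (ht : ∀ v w, B (t v) w = -B v (t w))
    (hE : ∀ b c v w, B c v * B (t (t b)) w - B v (t (t b)) * B c w +
      2 * (B (t c) v * B (t b) w - B v (t b) * B (t c) w) +
        (B (t (t c)) v * B b w - B v b * B (t (t c)) w) = 0) : t = 0 := by
  have : Invertible (2 : F) := invertibleOfNonzero h2
  obtain ⟨e, he⟩ := LinearMap.BilinForm.exists_orthogonal_basis (B := B) ⟨hB.eq⟩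
  have hd : ∀ i, B (e i) (e i) ≠ 0 := he.not_isOrtho_basis_self_of_separatingLeft hnd
  have ho : ∀ i j, i ≠ j → B (e i) (e j) = 0 := fun i j hij => he hij
  obtain ⟨S, hS⟩ : ∃ S : Fin (Module.finrank F W) → Fin (Module.finrank F W) → F,
    ∀ i j, B (t (e i)) (e j) = S i j := ⟨_, fun _ _ => rfl⟩
  obtain ⟨T, hT⟩ : ∃ T : Fin (Module.finrank F W) → Fin (Module.finrank F W) → F,
    ∀ i j, B (t (t (e i))) (e j) = T i j := ⟨_, fun _ _ => rfl⟩
  have hS' : ∀ i j, B (e j) (t (e i)) = S i j := fun i j => by rw [← hS, ← hB.eq]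
  have hT' : ∀ i j, B (e j) (t (t (e i))) = T i j := fun i j => by rw [← hT, ← hB.eq]
  have hSa : ∀ i j, S i j = -S j i := fun i j => by rw [← hS, ht, hS']
  have hSd : ∀ i, S i i = 0 := fun i =>
    (mul_eq_zero.1 (by linear_combination hSa i i : 2 * S i i = 0)).resolve_left h2
  have hTS : ∀ i j, T i j = -∑ l, S i l * S j l / B (e l) (e l) := by
    have hrepr : ∀ j l, e.repr (t (e j)) l = S j l / B (e l) (e l) := by
      intro j l
      rw [eq_div_iff (hd l), ← hS' j l]
      conv_rhs => rw [← e.sum_repr (t (e j))]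
      rw [map_sum, Finset.sum_eq_single l]
      · simp
      · intro k _ hk
        simp [ho l k hk.symm]
      · simp
    intro i j
    rw [← hT, ht]
    conv_lhs => rw [← e.sum_repr (t (e j))]
    rw [map_sum]
    congr 1
    refine Finset.sum_congr rfl fun l _ => ?_
    rw [map_smul, hS, hrepr, smul_eq_mul]
    ring
  have hdiag : ∀ i j, i ≠ j →
      T i i * B (e j) (e j) + B (e i) (e i) * T j j + 2 * (S i j * S i j) = 0 := by
    intro i j hij
    have := hE (e i) (e j) (e i) (e j)
    simp only [hS, hT, hS', hT', ho i j hij, ho j i hij.symm, hSd] at this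
    linear_combination -this + 2 * S i j * hSa j i
  have hmid : ∀ i j k, i ≠ j → i ≠ k → j ≠ k → 2 * (S j i * S i k) = B (e i) (e i) * T j k := by
    intro i j k hij hik hjk
    have := hE (e i) (e j) (e i) (e k)
    simp only [hS, hT, hS', hT', ho i k hik, ho j i hij.symm, ho j k hjk, hSd] at this
    linear_combination this
  have hfour : ∀ i j k l, i ≠ j → i ≠ k → i ≠ l → j ≠ k → j ≠ l → k ≠ l →
      S j k * S i l = S i k * S j l := by
    intro i j k l hij hik hil hjk hjl hkl
    have := hE (e i) (e j) (e k) (e l)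
    simp only [hS, hT, hS', hT', ho i l hil, ho j k hjk, ho j l hjl, ho k i hik.symm] at this
    refine mul_left_cancel₀ h2 ?_
    linear_combination this
  have hfour0 : ∀ i j k l, i ≠ j → i ≠ k → i ≠ l → j ≠ k → j ≠ l → k ≠ l →
      S i j * S k l = 0 := by
    intro i j k l hij hik hil hjk hjl hkl
    have ha := hfour i j k l hij hik hil hjk hjl hkl
    have hb := hfour i k j l hik hij hil hjk.symm hkl hjl
    have hc := hfour i l j k hil hij hik hjl.symm hkl.symm hjk
    rw [hSa k j] at hb
    rw [hSa l j, hSa l k] at hc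
    refine (mul_eq_zero.1 (?_ : (2 : F) * _ = 0)).resolve_left h2
    linear_combination -hb - ha + hc
  -- A fourth index `l` forces `T j k = 0`. Otherwise the dimension is 3, the sum for `T j k` has
  -- one term, and `hmid` reads `2X = X`.
  have hrow : ∀ i j k, i ≠ j → i ≠ k → j ≠ k → S i j * S i k = 0 := by
    intro i j k hij hik hjk
    have hi := hmid i j k hij hik hjk
    by_cases hl : ∃ l, l ≠ i ∧ l ≠ j ∧ l ≠ k
    · obtain ⟨l, hli, hlj, hlk⟩ := hl
      by_contra hne
      have hjl := hmid l j k hlj hlk hjk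
      have h0 := hfour0 i k j l hik hij hli.symm hjk.symm hlk.symm hlj.symm
      have hSjl : S j l = 0 := (mul_eq_zero.1 h0).resolve_left (right_ne_zero_of_mul hne)
      rw [hSjl, zero_mul, mul_zero] at hjl
      have hT0 : T j k = 0 := (mul_eq_zero.1 hjl.symm).resolve_left (hd l)
      rw [hT0, mul_zero, hSa j i] at hi
      have := (mul_eq_zero.1 hi).resolve_left h2
      exact hne (by linear_combination -this)
    · push Not at hl
      have hTjk : T j k = -(S j i * S k i / B (e i) (e i)) := by
        rw [hTS, Finset.sum_eq_single i]
        · intro l _ hli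
          by_cases hlj : l = j
          · rw [hlj, hSd, zero_mul, zero_div]
          · rw [hl l hli hlj, hSd, mul_zero, zero_div]
        · simp
      have hT2 : B (e i) (e i) * T j k = -(S j i * S k i) := by
        rw [hTjk, mul_neg, mul_div_cancel₀ _ (hd i)]
      rw [hT2, hSa j i, hSa k i] at hi
      linear_combination -hi
  have hzero : ∀ i j, S i j = 0 := by
    intro i j
    by_contra hne
    have hij : i ≠ j := fun h => hne (by rw [h, hSd])
    -- Dimension ≠ 2 enters here: row `k` of `S` vanishes, so `T` is zero at `k`, `i`, `j` on the
    -- diagonal and `2 * S i j ^ 2 = 0`.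
    obtain ⟨k, hki, hkj⟩ : ∃ k, k ≠ i ∧ k ≠ j := by
      by_contra hk
      push Not at hk
      apply hdim
      have huniv : (Finset.univ : Finset (Fin (Module.finrank F W))) = {i, j} := by
        ext k
        simp only [Finset.mem_univ, Finset.mem_insert, Finset.mem_singleton, true_iff]
        exact or_iff_not_imp_left.2 (hk k)
      rw [← Finset.card_pair hij, ← huniv, Finset.card_univ, Fintype.card_fin]
    have hik : S i k = 0 := (mul_eq_zero.1 (hrow i j k hij hki.symm hkj.symm)).resolve_left hne
    have hjk : S j k = 0 := (mul_eq_zero.1 (hrow j i k hij.symm hkj.symm hki.symm)).resolve_left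
      fun h => hne (by rw [hSa, h, neg_zero])
    have hk : ∀ l, S k l = 0 := by
      intro l
      by_cases hli : l = i
      · rw [hli, hSa, hik, neg_zero]
      by_cases hlj : l = j
      · rw [hlj, hSa, hjk, neg_zero]
      by_cases hlk : l = k
      · rw [hlk, hSd]
      exact (mul_eq_zero.1 (hfour0 i j k l hij (Ne.symm hki) (Ne.symm hli) (Ne.symm hkj)
        (Ne.symm hlj) (Ne.symm hlk))).resolve_left hne
    have hTk : T k k = 0 := by simp [hTS, hk]
    have h1 := hdiag i k hki.symm
    have h3 := hdiag j k hkj.symm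
    rw [hTk, hik] at h1
    rw [hTk, hjk] at h3
    have hTi : T i i = 0 := by simpa [hd k] using h1
    have hTj : T j j = 0 := by simpa [hd k] using h3
    have h4 := hdiag i j hij
    rw [hTi, hTj] at h4
    simp [h2, hne] at h4
  refine e.ext fun i => hnd _ fun w => ?_
  have : B (t (e i)) = 0 := e.ext fun j => by rw [hS, hzero, LinearMap.zero_apply]
  rw [this, LinearMap.zero_apply]

theorem lie_lie_eq_zero_of_mem {I : LieIdeal F (skewAdjointLieSubalgebra f)}
    (hI : IsLieAbelian I) {t : skewAdjointLieSubalgebra f} (ht : t ∈ I) {x : Module.End F V}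
    (hx : x ∈ skewAdjointLieSubalgebra f) : ⁅(t : Module.End F V), ⁅(t : Module.End F V), x⁆⁆ = 0 := by
  have hmem : ⁅t, (⟨x, hx⟩ : skewAdjointLieSubalgebra f)⁆ ∈ I := lie_mem_left F _ I _ _ ht
  have := hI.trivial (⟨t, ht⟩ : I) ⟨_, hmem⟩
  exact congrArg (fun z : I => ((z : skewAdjointLieSubalgebra f) : Module.End F V)) this

end SkewAdjoint

/-! ### The equivalence -/

theorem mainTheorem3 {F V : Type*} [Field F] [AddCommGroup V] [Module F V]
    [FiniteDimensional F V] [Nontrivial V] (f : LinearMap.BilinForm F V) :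
    LieAlgebra.HasTrivialRadical F (skewAdjointLieSubalgebra f) ↔
      ringChar F ≠ 2 ∧ f.Nondegenerate ∧
        ∃ V₁ V₂ : Submodule F V, IsPerpDecomp f V₁ V₂ ∧
          (f.restrict V₁).IsSymm ∧ Module.finrank F V₁ ≠ 2 ∧
          IsSkewSymmForm (f.restrict V₂) := by
  constructor
  · intro h
    have h2 := two_ne_zero_of_hasTrivialRadical h
    have hf := nondegenerate_of_hasTrivialRadical h
    have hsymm : ∀ u ∈ LinearMap.ker (f - f.flip), ∀ w, f w u = f u w := fun u hu w =>
      (sub_eq_zero.1 (LinearMap.congr_fun (LinearMap.mem_ker.1 hu) w)).symm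
    have hskew : ∀ u ∈ LinearMap.ker (f + f.flip), ∀ w, f w u = -f u w := fun u hu w =>
      eq_neg_of_add_eq_zero_right (LinearMap.congr_fun (LinearMap.mem_ker.1 hu) w)
    have hperp : ∀ u ∈ LinearMap.ker (f - f.flip), ∀ w ∈ LinearMap.ker (f + f.flip),
        f u w = 0 := fun u hu w hw =>
      (mul_eq_zero.1 (by linear_combination hskew w hw u - hsymm u hu w : 2 * f u w = 0)).resolve_left
        h2
    refine ⟨fun hchar => h2 ?_, hf, _, _, ⟨isCompl_ker_of_hasTrivialRadical h hf, hperp,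
      fun u hu w hw => ?_⟩, ⟨fun u w => ?_⟩, finrank_ker_ne_two h hf, fun u w => ?_⟩
    · have := ringChar.Nat.cast_ringChar (R := F)
      rwa [hchar] at this
    · rw [hsymm u hu w, hperp u hu w hw]
    · exact hsymm _ w.2 _
    · exact hskew _ w.2 _
  · rintro ⟨hchar, hf, V₁, V₂, hdec, hsymm, hdim, hskew⟩
    have h2 : (2 : F) ≠ 0 := Ring.two_ne_zero hchar
    have hsup : ∀ v, ∃ a ∈ V₁, ∃ b ∈ V₂, a + b = v := fun v =>
      Submodule.mem_sup.1 (hdec.isCompl.sup_eq_top ▸ Submodule.mem_top)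
    have h₁ : ∀ u ∈ V₁, f.flip u = (1 : F) • f u := by
      intro u hu
      ext v
      obtain ⟨a, ha, b, hb, rfl⟩ := hsup v
      have := hsymm.eq ⟨a, ha⟩ ⟨u, hu⟩
      simpa [hdec.left_perp u hu b hb, hdec.right_perp u hu b hb] using this
    have h₂ : ∀ u ∈ V₂, f.flip u = (-1 : F) • f u := by
      intro u hu
      ext v
      obtain ⟨a, ha, b, hb, rfl⟩ := hsup v
      have := hskew ⟨b, hb⟩ ⟨u, hu⟩
      simpa [hdec.left_perp a ha u hu, hdec.right_perp a ha u hu] using this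
    rw [LieAlgebra.hasTrivialRadical_iff_no_abelian_ideals]
    intro I hI
    rw [LieSubmodule.eq_bot_iff]
    rintro ⟨t, ht⟩ htI
    have ht' := mem_skewAdjointLieSubalgebra_iff.1 ht
    have hs : ∀ x ∈ skewAdjointLieSubalgebra f, ⁅t, ⁅t, x⁆⁆ = 0 := fun x hx =>
      lie_lie_eq_zero_of_mem hI htI hx
    have ht₂ : ∀ u ∈ V₂, t u = 0 := fun u hu =>
      apply_eq_zero_of_skew_of_sandwich h2 hf ht (h₂ u hu)
        (hs _ (smulRight_mem_of_flip_eq (by norm_num) (h₂ u hu) (h₂ u hu)))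
    -- Since `t` kills `V₂`, skew-adjointness makes `t u` orthogonal to `V₂`.
    have hmap : ∀ u ∈ V₁, t u ∈ V₁ := by
      intro u hu
      obtain ⟨a, ha, b, hb, hab⟩ := hsup (t u)
      have hb0 : b = 0 := by
        refine hf.1 b fun w => ?_
        obtain ⟨c, hc, d, hd, rfl⟩ := hsup w
        have h3 := ht' u d
        rw [ht₂ d hd, ← hab, map_add, LinearMap.add_apply, hdec.left_perp a ha d hd] at h3
        rw [map_add, hdec.right_perp c hc b hb]
        simpa using h3
      rw [← hab, hb0, add_zero]
      exact ha
    have ht₁ : t.restrict hmap = 0 := by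
      refine eq_zero_of_symm_of_sandwich h2 hsymm (fun u hu => ?_) hdim
        (fun v w => ht' v w) fun b c v w => ?_
      · refine Subtype.ext (hf.1 _ fun w => ?_)
        obtain ⟨c, hc, d, hd, rfl⟩ := hsup w
        rw [map_add, hdec.left_perp _ u.2 d hd, add_zero]
        exact hu ⟨c, hc⟩
      · have h3 := lie_lie_smulRight_apply ht (b : V) c v
        rw [hs _ (smulRight_mem_of_flip_eq (one_mul 1) (h₁ b b.2) (h₁ c c.2))] at h3
        have h4 := LinearMap.congr_fun (congrArg f h3) w
        simpa using h4.symm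
    refine Subtype.ext (LinearMap.ext fun v => ?_)
    obtain ⟨a, ha, b, hb, rfl⟩ := hsup v
    have h3 := congrArg Subtype.val (LinearMap.congr_fun ht₁ ⟨a, ha⟩)
    rw [map_add, ht₂ b hb, add_zero]
    exact h3
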